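/- **Setting.** Pursuers $i\in\mathcal V=\{1,\dots,n\}$, $n\ge 1$, move in the plane as unicycles $\dot x_i=V_i\cos\gamma_i$, $\dot y_i=V_i\sin\gamma_i$, $\dot\gamma_i=a_i/V_i$ with constant speeds $V_i>0$, towards a stationary target $T$. Let $R_i$ be the distance from pursuer $i$ to $T$, and let $\theta_i\in(-\pi,\pi]$ be its lead angle, i.e. the signed angle from its heading to its line of sight to $T$. Let $$a_i'=\frac{2V_i^2\sin\theta_i}{R_i},\qquad \tilde t_i=\frac{R_i\theta_i}{V_i\sin\theta_i}$$ be the lateral acceleration needed to reach $T$ along a circular arc, and the time this takes (the estimated time of interception). Assume $\theta_i(0)\notin\{0,\pi\}$ for all $i$. Let $\mathcal G=(\mathcal V,\mathcal E)$ be a static directed communication graph; $(i,j)\in\mathcal E$ means that $j$ is an out-neighbour of $i$, and every pursuer also senses itself. Put $M_i=\max\{\tilde t_i,\ \tilde t_j: (i,j)\in\mathcal E\}$. Until the first interception of $T$ by a pursuer, the pursuers follow the guidance law $$a_i=0\ \text{ if } \tilde t_i<M_i,\qquad a_i=a_i'\ \text{ if } \tilde t_i\ge M_i$$ for almost every time,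 with $\gamma_i$ equal to $\gamma_i(0)$ plus the integral of $a_i/V_i$. Infinitely fast switching is allowed in the following sense: at times at which $\tilde t_i=M_i$ and a pursuer $j$ with $\tilde t_j<M_j$ can be reached from $i$ along a directed path on which all estimated times are equal, $a_i$ may be any value between $0$ and $a_i'$. Positions are continuous for all times $t\ge 0$. Let $C(\mathcal G)=(\mathcal V_C,\mathcal E_C)$ be the condensation graph: its nodes are the strongly connected components of $\mathcal G$, and it has an edge from a component to a different one whenever $\mathcal G$ has an edge from a node of the first to a node of the second. For $k\in\mathcal V_C$ let $\mathcal T(k)\subseteq\mathcal V$ be the set of nodes condensed to $k$. Let $\mathcal S\subseteq\mathcal V_C$ be the set of sinks (no outgoing edge) and singletons (isolated nodes) of $C(\mathcal G)$, and let $$P=\bigcup_{k\in\mathcal S}\ \operatorname*{arg\,max}_{j\in\mathcal T(k)}\tilde t_j(0),$$ where $\operatorname{arg\,max}$ is the set of all maximizers. **Claim.** A minimizer of $\tilde t_i(0)$ over $i\in P$ exists, and every minimizer $f\in\operatorname*{arg\,min}_{i\in P}\tilde t_i(0)$ is a first pursuer to intercept $T$, at time $\tilde t_f(0)$: one has $\tilde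 t_f(0)>0$, pursuer $f$ is at $T$ at time $t=\tilde t_f(0)$, and no pursuer is at $T$ at any time $0\le t<\tilde t_f(0)$. -/

import Mathlib

namespace Pursuit

open Set MeasureTheory

/-! ### Engagement geometry -/

/-- Distance from a pursuer at `(x, y)` to the target at `(xt, yt)`. -/
noncomputable def targetDist (xt yt x y : ℝ) : ℝ := Real.sqrt ((xt - x) ^ 2 + (yt - y) ^ 2)

/-- Lead angle in `(-π, π]`: the signed angle from the heading direction `(cos γ, sin γ)` to the
line of sight from `(x, y)` to the target `(xt, yt)`. -/
noncomputable def leadAngle (xt yt x y γ : ℝ) : ℝ :=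
  Complex.arg ((⟨xt - x, yt - y⟩ : ℂ) * Complex.exp (-((γ : ℂ) * Complex.I)))

/-- Lateral acceleration `2 V² sin θ / R` that steers along the circular arc to the target. -/
noncomputable def circAccel (V R θ : ℝ) : ℝ := 2 * V ^ 2 * Real.sin θ / R

/-- Estimated time of interception `R θ / (V sin θ)`. -/
noncomputable def estTime (V R θ : ℝ) : ℝ := R * θ / (V * Real.sin θ)

/-- Poses `(x, y, γ)` and lateral accelerations `a` of `n` pursuers as functions of time. -/
structure Motion (n : ℕ) where
  x : Fin n → ℝ → ℝ
  y : Fin n → ℝ → ℝ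
  γ : Fin n → ℝ → ℝ
  a : Fin n → ℝ → ℝ

namespace Motion

variable {n : ℕ}

/-- Distance of pursuer `i` to the target at time `t`. -/
noncomputable def R (m : Motion n) (xt yt : ℝ) (i : Fin n) (t : ℝ) : ℝ :=
  targetDist xt yt (m.x i t) (m.y i t)

/-- Lead angle of pursuer `i` at time `t`. -/
noncomputable def θ (m : Motion n) (xt yt : ℝ) (i : Fin n) (t : ℝ) : ℝ :=
  leadAngle xt yt (m.x i t) (m.y i t) (m.γ i t)

/-- Estimated time of interception of pursuer `i` at time `t`. -/
noncomputable def tTilde (m : Motion n) (V : Fin n → ℝ) (xt yt : ℝ) (t : ℝ) (i : Fin n) : ℝ :=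
  estTime (V i) (m.R xt yt i t) (m.θ xt yt i t)

/-- Pursuer `i` is at the target at time `t`. -/
def InterceptsAt (m : Motion n) (xt yt : ℝ) (i : Fin n) (t : ℝ) : Prop :=
  m.x i t = xt ∧ m.y i t = yt

/-- The times `t ≥ 0` up to which (inclusive) no pursuer has intercepted the target. -/
def engaged (m : Motion n) (xt yt : ℝ) : Set ℝ :=
  {t | 0 ≤ t ∧ ∀ s ∈ Icc 0 t, ∀ i, ¬ m.InterceptsAt xt yt i s}

end Motion

/-! ### Guidance law -/

variable {n : ℕ}

open Classical in
/-- Largest value of `τ` among pursuer `i` and its out-neighbours. (Every pursuer senses its own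
pose, i.e. every node carries a self-loop.) -/
noncomputable def maxOut (G : Digraph (Fin n)) (τ : Fin n → ℝ) (i : Fin n) : ℝ :=
  (insert i (Finset.univ.filter fun j => G.Adj i j)).sup' (Finset.insert_nonempty _ _) τ

/-- Starting from `i` and repeatedly passing to an out-neighbour with the same estimated time, one
can arrive at a pursuer that flies straight, i.e. one which is strictly below the maximum of its
out-neighbours. In this situation `i`, when it is level with the maximum of its out-neighbours, may
be unable to stay on the circle: it then keeps switching between circle and straight line. -/
def TiedToStraight (G : Digraph (Fin n)) (τ : Fin n → ℝ) (i : Fin n) : Prop :=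
  ∃ j, Relation.ReflTransGen (fun k l => G.Adj k l ∧ τ l = τ k) i j ∧ τ j < maxOut G τ j

/-- The guidance law for pursuer `i`, with `τ` the estimated times of interception, `a` its lateral
acceleration and `a'` the lateral acceleration for the circular path: `a = 0` if `τ i` is below the
maximum over the out-neighbours and `a = a'` otherwise. At a tie with the maximum that is
inherited from a pursuer flying straight, infinitely fast switching between the two values is
allowed as well; it appears as an averaged value between `0` and `a'`. -/
def GuidanceLaw (G : Digraph (Fin n)) (τ : Fin n → ℝ) (i : Fin n) (a a' : ℝ) : Prop :=
  (τ i < maxOut G τ i → a = 0) ∧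
  (maxOut G τ i ≤ τ i →
    a = a' ∨ (TiedToStraight G τ i ∧ a ∈ segment ℝ 0 a'))

/-- `m` is a motion of unicycles `x' = V cos γ`, `y' = V sin γ`, `γ' = a / V` with constant speeds
`V i` which obey the guidance law over the static communication graph `G`, for as long as no pursuer
has intercepted the target. The equation for `γ` is meant in the sense of Carathéodory, since `a` is
discontinuous. Nothing but continuity of the positions is required from the first interception
onwards. -/
structure Follows (G : Digraph (Fin n)) (V : Fin n → ℝ) (xt yt : ℝ) (m : Motion n) : Prop where
  cont_x : ∀ i, ContinuousOn (m.x i) (Ici 0)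
  cont_y : ∀ i, ContinuousOn (m.y i) (Ici 0)
  deriv_x : ∀ i, ∀ t ∈ m.engaged xt yt,
    HasDerivWithinAt (m.x i) (V i * Real.cos (m.γ i t)) (Ici 0) t
  deriv_y : ∀ i, ∀ t ∈ m.engaged xt yt,
    HasDerivWithinAt (m.y i) (V i * Real.sin (m.γ i t)) (Ici 0) t
  integrable_a : ∀ i, ∀ t ∈ m.engaged xt yt, IntervalIntegrable (m.a i) volume 0 t
  heading : ∀ i, ∀ t ∈ m.engaged xt yt,
    m.γ i t = m.γ i 0 + ∫ s in (0 : ℝ)..t, m.a i s / V i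
  law : ∀ᵐ t, t ∈ m.engaged xt yt → ∀ i,
    GuidanceLaw G (m.tTilde V xt yt t) i (m.a i t)
      (circAccel (V i) (m.R xt yt i t) (m.θ xt yt i t))

/-! ### Condensation graph -/

/-- Two nodes are in the same strongly connected component if each is reachable from the other
along a directed path. -/
def sccSetoid (G : Digraph (Fin n)) : Setoid (Fin n) where
  r i j := Relation.ReflTransGen G.Adj i j ∧ Relation.ReflTransGen G.Adj j i
  iseqv := ⟨fun _ => ⟨.refl, .refl⟩, fun h => ⟨h.2, h.1⟩,
    fun h k => ⟨h.1.trans k.1, k.2.trans h.2⟩⟩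

/-- The strongly connected components of `G`, the nodes of the condensation graph. -/
abbrev SCC (G : Digraph (Fin n)) : Type := Quotient (sccSetoid G)

/-- The condensation graph `C(G)`: an edge from one component to a different one whenever `G` has an
edge from a node of the former to a node of the latter. -/
def condensation (G : Digraph (Fin n)) : Digraph (SCC G) where
  Adj c d := c ≠ d ∧ ∃ i j, G.Adj i j ∧ Quotient.mk (sccSetoid G) i = c ∧
    Quotient.mk (sccSetoid G) j = d

/-- The nodes of `G` condensed to `c`. -/
def members (G : Digraph (Fin n)) (c : SCC G) : Set (Fin n) :=
  {i | Quotient.mk (sccSetoid G) i = c}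

/-- A node without outgoing edges. -/
def IsSink {W : Type*} (H : Digraph W) (c : W) : Prop := ∀ d, ¬ H.Adj c d

/-- An isolated node: no outgoing and no incoming edges. -/
def IsSingleton {W : Type*} (H : Digraph W) (c : W) : Prop := ∀ d, ¬ H.Adj c d ∧ ¬ H.Adj d c

/-- The sinks and singletons of the condensation graph. -/
def terminal (G : Digraph (Fin n)) : Set (SCC G) :=
  {c | IsSink (condensation G) c ∨ IsSingleton (condensation G) c}

/-- The set of maximizers of `τ` on `s`. -/
def argmaxOn {W : Type*} (τ : W → ℝ) (s : Set W) : Set W := {j | j ∈ s ∧ ∀ i ∈ s, τ i ≤ τ j}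

/-- The set of minimizers of `τ` on `s`. -/
def argminOn {W : Type*} (τ : W → ℝ) (s : Set W) : Set W := {j | j ∈ s ∧ ∀ i ∈ s, τ j ≤ τ i}

/-- The local leaders: the pursuers with the largest value of `τ` within some sink or singleton
component. -/
def localLeaders (G : Digraph (Fin n)) (τ : Fin n → ℝ) : Set (Fin n) :=
  ⋃ c ∈ terminal G, argmaxOn τ (members G c)

end Pursuit

namespace Pursuit

open Set MeasureTheory Filter Topology

/-! ### Lipschitz functions with a sign condition on the derivative -/

/-! Let `z` be the target's position in a pursuer's body frame, so that `z' = -V - i (a/V) z` almost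
everywhere. If `a` is the fraction `l ∈ [0,1]` of the circular acceleration, the predicted arrival
time `t̃ + t` has derivative `2(1-l)(1 - θ cot θ) ≥ 0`, which vanishes on the circle. Predictions
therefore never move earlier (`Follows.monotoneOn_tTilde_add`). In a sink component, a current
maximizer of `t̃` cannot see a larger value or be tied to a straight flyer, so it flies its circle.
Hence the component's maximum of `t̃ + t` does not grow, and the prediction of an initial maximizer,
squeezed below it, is constant (`Follows.tTilde_localLeader`). Since `R ≤ V t̃`, this pursuer is at
the target when its prediction falls due, unless the engagement ends before. Conversely, let `i`
make the first interception, at time `T`. Arbitrarily close to `T` it is near the target with the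
target not behind it, so `t̃` is small there, and monotonicity gives `t̃_i + s ≤ T` for all `s < T`.
This bound passes along each edge `j → k`: if `k` exceeded it once, `k` would do so from then on,
`j` would fly straight with constant nonzero cross-range, and `t̃_j` could not tend to `0`. Every
node reaches a local leader, so some leader has initial estimate at most `T`
(`Follows.exists_localLeader_le_of_intercepts`). -/

theorem monotoneOn_of_lipschitz_of_ae_hasDerivAt {f : ℝ → ℝ} {S : ℝ} {K : NNReal}
    (hf : LipschitzOnWith K f (Icc 0 S))
    (hd : ∀ᵐ t, t ∈ Ioo 0 S → ∃ f', 0 ≤ f' ∧ HasDerivAt f f' t) : MonotoneOn f (Icc 0 S) := by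
  intro s hs t ht hst
  have hsub : uIcc s t ⊆ Icc 0 S := by
    rw [uIcc_of_le hst]; exact Icc_subset_Icc hs.1 ht.2
  -- Absolute continuity makes increments integrals of the derivative, so a sign almost everywhere
  -- is enough.
  have hac := (hf.mono hsub).absolutelyContinuousOnInterval
  have h := hac.integral_deriv_eq_sub
  have h0 : 0 ≤ ∫ u in s..t, deriv f u := by
    apply intervalIntegral.integral_nonneg_of_ae_restrict hst
    rw [Filter.EventuallyLE, ae_restrict_iff' measurableSet_Icc]
    have h1 : ∀ᵐ u : ℝ, u ≠ 0 := by simp [ae_iff, measure_singleton]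
    have h2 : ∀ᵐ u : ℝ, u ≠ S := by simp [ae_iff, measure_singleton]
    filter_upwards [hd, h1, h2] with u hu hu0 huS huI
    obtain ⟨f', hf', hder⟩ := hu ⟨lt_of_le_of_ne (hs.1.trans huI.1) hu0.symm,
      lt_of_le_of_ne (huI.2.trans ht.2) huS⟩
    simpa [hder.deriv] using hf'
  linarith

theorem lipschitzOnWith_comp_of_contDiffAt {E F : Type*} [NormedAddCommGroup E] [NormedSpace ℝ E]
    [NormedAddCommGroup F] [NormedSpace ℝ F] {p : ℝ → E} {Φ : E → F} {S : ℝ} {K : NNReal}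
    (hp : LipschitzOnWith K p (Icc 0 S)) (hΦ : ∀ t ∈ Icc 0 S, ContDiffAt ℝ 1 Φ (p t)) :
    ∃ K', LipschitzOnWith K' (fun t => Φ (p t)) (Icc 0 S) := by
  refine LocallyLipschitzOn.exists_lipschitzOnWith_of_compact isCompact_Icc fun t ht => ?_
  obtain ⟨L, u, hu, hL⟩ := (hΦ t ht).exists_lipschitzOnWith
  exact ⟨L * K, p ⁻¹' u ∩ Icc 0 S, inter_mem (hp.continuousOn t ht hu) self_mem_nhdsWithin,
    hL.comp (hp.mono inter_subset_right) fun _ h => h.1⟩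

/-! ### Trigonometric inequalities -/

/-- Gives the sign of `1 - θ cot θ`, hence of the drift of the predicted arrival time. By evenness
only `θ ≥ 0` matters: use `θ ≤ tan θ` below `π/2`, and the sign of the cosine above. -/
theorem mul_cos_div_sin_le_one {θ : ℝ} (h0 : Real.sin θ ≠ 0) (h1 : |θ| ≤ Real.pi) :
    θ * Real.cos θ / Real.sin θ ≤ 1 := by
  have key : ∀ φ : ℝ, 0 ≤ φ → φ ≤ Real.pi → φ * Real.cos φ ≤ Real.sin φ := by
    intro φ hφ hφ'
    rcases lt_or_ge φ (Real.pi / 2) with h | h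
    · have := Real.le_tan hφ h
      have hc : 0 < Real.cos φ := Real.cos_pos_of_mem_Ioo ⟨by linarith [Real.pi_pos], h⟩
      rwa [Real.tan_eq_sin_div_cos, le_div_iff₀ hc] at this
    · have hc := Real.cos_nonpos_of_pi_div_two_le_of_le h (by linarith [Real.pi_pos])
      have := Real.sin_nonneg_of_nonneg_of_le_pi hφ hφ'
      nlinarith
  rcases le_total 0 θ with h | h
  · have hs : 0 < Real.sin θ := lt_of_le_of_ne
      (Real.sin_nonneg_of_nonneg_of_le_pi h (by rwa [abs_of_nonneg h] at h1)) h0.symm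
    rw [div_le_one hs]
    exact key θ h (by rwa [abs_of_nonneg h] at h1)
  · rw [abs_of_nonpos h] at h1
    have hs : 0 < Real.sin (-θ) := lt_of_le_of_ne
      (Real.sin_nonneg_of_nonneg_of_le_pi (by linarith) h1) (by rw [Real.sin_neg]; exact (neg_ne_zero.2 h0).symm)
    have := key (-θ) (by linarith) h1
    rw [← neg_div_neg_eq, div_le_one (by simpa using hs)]
    simpa using this

theorem one_le_div_sin {θ : ℝ} (h0 : Real.sin θ ≠ 0) (h1 : |θ| ≤ Real.pi) :
    1 ≤ θ / Real.sin θ := by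
  rcases le_total 0 θ with h | h
  · rw [abs_of_nonneg h] at h1
    have hs : 0 < Real.sin θ := lt_of_le_of_ne
      (Real.sin_nonneg_of_nonneg_of_le_pi h h1) h0.symm
    rw [one_le_div hs]
    exact Real.sin_le h
  · rw [abs_of_nonpos h] at h1
    have hs : 0 < Real.sin (-θ) := lt_of_le_of_ne
      (Real.sin_nonneg_of_nonneg_of_le_pi (by linarith) h1) (by rw [Real.sin_neg]; exact (neg_ne_zero.2 h0).symm)
    rw [← neg_div_neg_eq, one_le_div (by simpa using hs), ← Real.sin_neg]
    exact Real.sin_le (by linarith)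

theorem div_sin_le_pi_div_two {θ : ℝ} (h0 : Real.sin θ ≠ 0) (h1 : |θ| ≤ Real.pi / 2) :
    θ / Real.sin θ ≤ Real.pi / 2 := by
  have key : ∀ φ : ℝ, 0 ≤ φ → φ ≤ Real.pi / 2 → φ ≤ Real.pi / 2 * Real.sin φ := by
    intro φ hφ hφ'
    have := Real.mul_le_sin hφ hφ'
    have h2 : Real.pi / 2 * (2 / Real.pi * φ) = φ := by field_simp
    nlinarith [Real.pi_pos]
  rcases le_total 0 θ with h | h
  · rw [abs_of_nonneg h] at h1
    have hs : 0 < Real.sin θ := lt_of_le_of_ne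
      (Real.sin_nonneg_of_nonneg_of_le_pi h (by linarith [Real.pi_pos])) h0.symm
    rw [div_le_iff₀ hs]
    exact key θ h h1
  · rw [abs_of_nonpos h] at h1
    have hs : 0 < Real.sin (-θ) := lt_of_le_of_ne
      (Real.sin_nonneg_of_nonneg_of_le_pi (by linarith) (by linarith [Real.pi_pos]))
      (by rw [Real.sin_neg]; exact (neg_ne_zero.2 h0).symm)
    rw [← neg_div_neg_eq, div_le_iff₀ (by simpa using hs), ← Real.sin_neg]
    exact key (-θ) (by linarith) h1

/-! ### Relative position in the body frame -/

/-- Estimated time of interception as a function of the relative position in the body frame. -/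
noncomputable def estTimeOfPos (V : ℝ) (z : ℂ) : ℝ := Complex.normSq z * z.arg / (V * z.im)

theorem estTime_norm_arg (V : ℝ) (z : ℂ) : estTime V ‖z‖ z.arg = estTimeOfPos V z := by
  unfold estTime estTimeOfPos
  rcases eq_or_ne z 0 with rfl | hz
  · simp
  have hz' : ‖z‖ ≠ 0 := norm_ne_zero_iff.2 hz
  rw [Complex.sin_arg, Complex.normSq_eq_norm_sq]
  rcases eq_or_ne z.im 0 with h | h
  · simp [h]
  rcases eq_or_ne V 0 with rfl | hV
  · simp
  field_simp

theorem circAccel_norm_arg (V : ℝ) (z : ℂ) :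
    circAccel V ‖z‖ z.arg = 2 * V ^ 2 * z.im / Complex.normSq z := by
  unfold circAccel
  rw [Complex.sin_arg, Complex.normSq_eq_norm_sq]
  rcases eq_or_ne z 0 with rfl | hz
  · simp
  have hz' : ‖z‖ ≠ 0 := norm_ne_zero_iff.2 hz
  field_simp

/-- Nonzero cross-range avoids both the branch cut of `arg` and the zero of the denominator. -/
theorem contDiffAt_estTimeOfPos {V : ℝ} (hV : V ≠ 0) {z : ℂ} (hz : z.im ≠ 0) :
    ContDiffAt ℝ 1 (estTimeOfPos V) z := by
  have hlog : ContDiffAt ℝ 1 Complex.log z :=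
    (Complex.contDiffAt_log (Complex.mem_slitPlane_iff.2 (Or.inr hz))).restrict_scalars ℝ
  have hre : ContDiff ℝ 1 (fun z : ℂ => z.re) := Complex.reCLM.contDiff
  have him : ContDiff ℝ 1 (fun z : ℂ => z.im) := Complex.imCLM.contDiff
  have harg : ContDiffAt ℝ 1 (fun z : ℂ => z.arg) z := by
    have := him.contDiffAt.comp z hlog
    simpa [Function.comp_def, Complex.log_im] using this
  unfold estTimeOfPos
  simp only [Complex.normSq_apply]
  refine ContDiffAt.div ?_ ?_ (mul_ne_zero hV hz)
  · exact ((hre.contDiffAt.mul hre.contDiffAt).add (him.contDiffAt.mul him.contDiffAt)).mul harg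
  · exact contDiffAt_const.mul him.contDiffAt

theorem sin_arg_ne_zero {z : ℂ} (hz : z.im ≠ 0) : Real.sin z.arg ≠ 0 := by
  rw [Complex.sin_arg]
  have : z ≠ 0 := by rintro rfl; simp at hz
  exact div_ne_zero hz (norm_ne_zero_iff.2 this)

/-- The chord is no longer than the arc. -/
theorem norm_le_estTimeOfPos {V : ℝ} (hV : 0 < V) {z : ℂ} (hz : z.im ≠ 0) :
    ‖z‖ ≤ V * estTimeOfPos V z := by
  have h := one_le_div_sin (sin_arg_ne_zero hz) (Complex.abs_arg_le_pi z)
  rw [← estTime_norm_arg, estTime]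
  have hs := sin_arg_ne_zero hz
  have : V * (‖z‖ * z.arg / (V * Real.sin z.arg)) = ‖z‖ * (z.arg / Real.sin z.arg) := by
    field_simp
  rw [this]
  nlinarith [norm_nonneg z]

theorem estTimeOfPos_le_norm {V : ℝ} (hV : 0 < V) {z : ℂ} (hz : z.im ≠ 0) (hre : 0 ≤ z.re) :
    V * estTimeOfPos V z ≤ Real.pi / 2 * ‖z‖ := by
  have h := div_sin_le_pi_div_two (sin_arg_ne_zero hz) (Complex.abs_arg_le_pi_div_two_iff.2 hre)
  rw [← estTime_norm_arg, estTime]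
  have hs := sin_arg_ne_zero hz
  have : V * (‖z‖ * z.arg / (V * Real.sin z.arg)) = ‖z‖ * (z.arg / Real.sin z.arg) := by
    field_simp
  rw [this]
  nlinarith [norm_nonneg z]

theorem arg_mul_re_div_im_le_one {z : ℂ} (hz : z.im ≠ 0) : z.arg * z.re / z.im ≤ 1 := by
  have h := mul_cos_div_sin_le_one (sin_arg_ne_zero hz) (Complex.abs_arg_le_pi z)
  have h0 : z ≠ 0 := by rintro rfl; simp at hz
  rw [Complex.cos_arg h0, Complex.sin_arg] at h
  have hn : ‖z‖ ≠ 0 := norm_ne_zero_iff.2 h0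
  convert h using 1
  field_simp

/-- Estimated time of interception along a unicycle motion that turns with a fraction `l` of the
circular acceleration. -/
theorem hasDerivAt_estTimeOfPos {V a l t : ℝ} (hV : 0 < V) {z : ℝ → ℂ} (hz : (z t).im ≠ 0)
    (ha : a = l * (2 * V ^ 2 * (z t).im / Complex.normSq (z t)))
    (hd : HasDerivAt z (-(V : ℂ) - (a / V : ℝ) * Complex.I * z t) t) :
    HasDerivAt (fun s => estTimeOfPos V (z s))
      (-1 + 2 * (1 - l) * (1 - (z t).arg * (z t).re / (z t).im)) t := by
  have hre : HasDerivAt (fun s => (z s).re) (-V + a / V * (z t).im) t := by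
    have := Complex.reCLM.hasFDerivAt.comp_hasDerivAt t hd
    convert! this using 1
    simp
  have him : HasDerivAt (fun s => (z s).im) (-(a / V * (z t).re)) t := by
    have := Complex.imCLM.hasFDerivAt.comp_hasDerivAt t hd
    convert! this using 1
    simp
  have hn : Complex.normSq (z t) ≠ 0 := by
    rw [Ne, Complex.normSq_eq_zero]; intro h; simp [h] at hz
  have hn' : (z t).re * (z t).re + (z t).im * (z t).im ≠ 0 := by
    rwa [Complex.normSq_apply] at hn
  have harg : HasDerivAt (fun s => (z s).arg)
      (((-(a / V * (z t).re)) * (z t).re - (-V + a / V * (z t).im) * (z t).im)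
        / Complex.normSq (z t)) t := by
    have h1 := hd.clog_real (Complex.mem_slitPlane_iff.2 (Or.inr hz))
    have := Complex.imCLM.hasFDerivAt.comp_hasDerivAt t h1
    convert! this using 1
    · ext s; exact (Complex.log_im _).symm
    · rw [Complex.imCLM_apply, Complex.div_im]
      simp
      field_simp
  have hsq : HasDerivAt (fun s => Complex.normSq (z s)) (-2 * V * (z t).re) t := by
    simp only [Complex.normSq_apply]
    convert! (hre.mul hre).add (him.mul him) using 1
    ring
  have := (hsq.mul harg).div (him.const_mul V) (mul_ne_zero hV.ne' hz)
  unfold estTimeOfPos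
  convert! this using 1
  rw [ha, Pi.mul_apply]
  simp only [Complex.normSq_apply]
  field_simp
  ring

/-! ### Motions following the guidance law -/

/-- Relative position of the target in the body frame of pursuer `i`. -/
noncomputable def Motion.relPos {n : ℕ} (m : Motion n) (xt yt : ℝ) (i : Fin n) (t : ℝ) : ℂ :=
  (⟨xt - m.x i t, yt - m.y i t⟩ : ℂ) * Complex.exp (-((m.γ i t : ℂ) * Complex.I))

theorem norm_mk_mul_exp (u v g : ℝ) :
    ‖(⟨u, v⟩ : ℂ) * Complex.exp (-((g : ℂ) * Complex.I))‖ = Real.sqrt (u ^ 2 + v ^ 2) := by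
  rw [norm_mul, ← neg_mul, ← Complex.ofReal_neg, Complex.norm_exp_ofReal_mul_I, mul_one,
    Complex.norm_def, Complex.normSq_mk]
  congr 1
  ring

variable {n : ℕ} {G : Digraph (Fin n)} {V : Fin n → ℝ} {xt yt : ℝ} {m : Motion n}

theorem Motion.R_eq_norm (m : Motion n) (xt yt : ℝ) (i : Fin n) (t : ℝ) :
    m.R xt yt i t = ‖m.relPos xt yt i t‖ := (norm_mk_mul_exp _ _ _).symm

theorem Motion.θ_eq_arg (m : Motion n) (xt yt : ℝ) (i : Fin n) (t : ℝ) :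
    m.θ xt yt i t = (m.relPos xt yt i t).arg := rfl

theorem Motion.tTilde_eq (m : Motion n) (V : Fin n → ℝ) (xt yt : ℝ) (i : Fin n) (t : ℝ) :
    m.tTilde V xt yt t i = estTimeOfPos (V i) (m.relPos xt yt i t) := by
  rw [← estTime_norm_arg, ← m.R_eq_norm]; rfl

theorem Motion.interceptsAt_iff (m : Motion n) (xt yt : ℝ) (i : Fin n) (t : ℝ) :
    m.InterceptsAt xt yt i t ↔ m.R xt yt i t = 0 := by
  unfold Motion.InterceptsAt Motion.R targetDist
  rw [Real.sqrt_eq_zero (by positivity)]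
  constructor
  · rintro ⟨h1, h2⟩; rw [h1, h2]; ring
  · intro h
    constructor <;> nlinarith [sq_nonneg (xt - m.x i t), sq_nonneg (yt - m.y i t)]

theorem Motion.engaged_of_le {s t : ℝ} (ht : t ∈ m.engaged xt yt) (hs : 0 ≤ s) (hst : s ≤ t) :
    s ∈ m.engaged xt yt :=
  ⟨hs, fun u hu => ht.2 u ⟨hu.1, hu.2.trans hst⟩⟩

theorem Motion.relPos_ne_zero {t : ℝ} (ht : t ∈ m.engaged xt yt) (i : Fin n) :
    m.relPos xt yt i t ≠ 0 := by
  have := ht.2 t ⟨ht.1, le_rfl⟩ i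
  rwa [m.interceptsAt_iff, m.R_eq_norm, norm_eq_zero] at this

/-- Unifies the modes: ratio `0` is straight flight, `1` the circle, and values between them
averaged switching. -/
theorem GuidanceLaw.exists_ratio {τ : Fin n → ℝ} {i : Fin n} {a a' : ℝ}
    (h : GuidanceLaw G τ i a a') : ∃ l, 0 ≤ l ∧ l ≤ 1 ∧ a = l * a' := by
  rcases lt_or_ge (τ i) (maxOut G τ i) with hlt | hge
  · exact ⟨0, le_rfl, zero_le_one, by simpa using h.1 hlt⟩
  · rcases h.2 hge with h | ⟨-, p, q, hp, hq, hpq, rfl⟩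
    · exact ⟨1, zero_le_one, le_rfl, by simpa using h⟩
    · exact ⟨q, hq, by linarith, by simp⟩

namespace Follows

theorem continuousOn_R (hm : Follows G V xt yt m) (i : Fin n) :
    ContinuousOn (m.R xt yt i) (Ici 0) := by
  have hx := hm.cont_x i
  have hy := hm.cont_y i
  unfold Motion.R targetDist
  fun_prop

/-- Almost everywhere, the lateral acceleration is a fraction of the circular one. -/
theorem ae_exists_ratio (hm : Follows G V xt yt m) (i : Fin n) :
    ∀ᵐ t, t ∈ m.engaged xt yt → ∃ l, 0 ≤ l ∧ l ≤ 1 ∧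
      m.a i t = l * (2 * V i ^ 2 * (m.relPos xt yt i t).im /
        Complex.normSq (m.relPos xt yt i t)) := by
  filter_upwards [hm.law] with t ht hte
  obtain ⟨l, h0, h1, h⟩ := (ht hte i).exists_ratio
  refine ⟨l, h0, h1, ?_⟩
  rwa [m.R_eq_norm, m.θ_eq_arg, circAccel_norm_arg] at h

/-- The circular acceleration is at most `2 V² / R`, and `R` has a positive minimum on a compact
interval without interceptions. -/
theorem exists_accel_bound (hm : Follows G V xt yt m) (i : Fin n) {S : ℝ}
    (hS : S ∈ m.engaged xt yt) : ∃ C, 0 ≤ C ∧ ∀ᵐ t, t ∈ Icc 0 S → |m.a i t| ≤ C := by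
  have hc : ContinuousOn (m.R xt yt i) (Icc 0 S) := (hm.continuousOn_R i).mono Icc_subset_Ici_self
  obtain ⟨t₀, ht₀, hmin⟩ := isCompact_Icc.exists_isMinOn (nonempty_Icc.2 hS.1) hc
  have hpos : ∀ t ∈ Icc 0 S, 0 < ‖m.relPos xt yt i t‖ := fun t ht =>
    norm_pos_iff.2 (Motion.relPos_ne_zero (Motion.engaged_of_le hS ht.1 ht.2) i)
  refine ⟨2 * V i ^ 2 / m.R xt yt i t₀, ?_, ?_⟩
  · rw [m.R_eq_norm]; positivity
  filter_upwards [hm.ae_exists_ratio i] with t ht htI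
  obtain ⟨l, h0, h1, h⟩ := ht (Motion.engaged_of_le hS htI.1 htI.2)
  have hR : m.R xt yt i t₀ ≤ m.R xt yt i t := hmin htI
  rw [m.R_eq_norm, m.R_eq_norm] at hR
  have hp := hpos t htI
  have him : |(m.relPos xt yt i t).im| ≤ ‖m.relPos xt yt i t‖ := Complex.abs_im_le_norm _
  rw [h, abs_mul, abs_div, abs_mul, abs_of_nonneg h0, Complex.normSq_eq_norm_sq, m.R_eq_norm,
    abs_of_nonneg (by positivity : 0 ≤ 2 * V i ^ 2), abs_of_nonneg (sq_nonneg ‖_‖)]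
  calc l * (2 * V i ^ 2 * |(m.relPos xt yt i t).im| / ‖m.relPos xt yt i t‖ ^ 2)
      ≤ 1 * (2 * V i ^ 2 * ‖m.relPos xt yt i t‖ / ‖m.relPos xt yt i t‖ ^ 2) := by
        gcongr
    _ = 2 * V i ^ 2 / ‖m.relPos xt yt i t‖ := by field_simp
    _ ≤ _ := by
        gcongr
        exact hpos t₀ ht₀

theorem intervalIntegrable_turnRate (hm : Follows G V xt yt m) (i : Fin n) {S : ℝ}
    (hS : S ∈ m.engaged xt yt) :
    IntervalIntegrable (fun s => m.a i s / V i) volume 0 S :=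
  (hm.integrable_a i S hS).div_const _

theorem heading_lipschitz (hm : Follows G V xt yt m) (i : Fin n) {S : ℝ}
    (hS : S ∈ m.engaged xt yt) : ∃ K, LipschitzOnWith K (m.γ i) (Icc 0 S) := by
  obtain ⟨C, hC0, hC⟩ := hm.exists_accel_bound i hS
  refine ⟨Real.toNNReal (C / |V i|), LipschitzOnWith.of_dist_le_mul fun s hs t ht => ?_⟩
  have hsS := Motion.engaged_of_le hS hs.1 hs.2
  have htS := Motion.engaged_of_le hS ht.1 ht.2
  rw [Real.coe_toNNReal _ (by positivity), Real.dist_eq, Real.dist_eq, hm.heading i s hsS,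
    hm.heading i t htS, add_sub_add_left_eq_sub,
    intervalIntegral.integral_interval_sub_left (hm.intervalIntegrable_turnRate i hsS)
      (hm.intervalIntegrable_turnRate i htS), ← Real.norm_eq_abs]
  refine intervalIntegral.norm_integral_le_of_norm_le_const_ae ?_
  filter_upwards [hC] with u hu huI
  have : u ∈ Icc 0 S := by
    have := uIoc_subset_uIcc huI
    exact (uIcc_subset_Icc ht hs) this
  rw [norm_div, Real.norm_eq_abs, Real.norm_eq_abs]
  gcongr
  exact hu this

theorem relPos_lipschitz (hm : Follows G V xt yt m) (i : Fin n) {S : ℝ}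
    (hS : S ∈ m.engaged xt yt) : ∃ K, LipschitzOnWith K (m.relPos xt yt i) (Icc 0 S) := by
  obtain ⟨K, hK⟩ := hm.heading_lipschitz i hS
  have hx : LipschitzOnWith ‖V i‖₊ (m.x i) (Icc 0 S) := by
    refine (convex_Icc 0 S).lipschitzOnWith_of_nnnorm_hasDerivWithin_le
      (fun t ht => (hm.deriv_x i t (Motion.engaged_of_le hS ht.1 ht.2)).mono Icc_subset_Ici_self)
      fun t _ => ?_
    rw [← NNReal.coe_le_coe, coe_nnnorm, coe_nnnorm, norm_mul]
    exact mul_le_of_le_one_right (norm_nonneg _) (Real.abs_cos_le_one _)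
  have hy : LipschitzOnWith ‖V i‖₊ (m.y i) (Icc 0 S) := by
    refine (convex_Icc 0 S).lipschitzOnWith_of_nnnorm_hasDerivWithin_le
      (fun t ht => (hm.deriv_y i t (Motion.engaged_of_le hS ht.1 ht.2)).mono Icc_subset_Ici_self)
      fun t _ => ?_
    rw [← NNReal.coe_le_coe, coe_nnnorm, coe_nnnorm, norm_mul]
    exact mul_le_of_le_one_right (norm_nonneg _) (Real.abs_sin_le_one _)
  -- The relative position is a smooth function of the Lipschitz pose.
  let Φ : ℝ × ℝ × ℝ → ℂ := fun p => (((xt - p.1 : ℝ) : ℂ) + ((yt - p.2.1 : ℝ) : ℂ) * Complex.I) *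
    Complex.exp (-((p.2.2 : ℂ) * Complex.I))
  have hΦ : ContDiff ℝ 1 Φ := by
    have hc : ContDiff ℝ 1 (fun r : ℝ => (r : ℂ)) := Complex.ofRealCLM.contDiff
    have h1 : ContDiff ℝ 1 fun p : ℝ × ℝ × ℝ => ((xt - p.1 : ℝ) : ℂ) :=
      hc.comp (contDiff_const.sub contDiff_fst)
    have h2 : ContDiff ℝ 1 fun p : ℝ × ℝ × ℝ => ((yt - p.2.1 : ℝ) : ℂ) :=
      hc.comp (contDiff_const.sub (contDiff_fst.comp contDiff_snd))
    have h3 : ContDiff ℝ 1 fun p : ℝ × ℝ × ℝ => (p.2.2 : ℂ) :=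
      hc.comp (contDiff_snd.comp contDiff_snd)
    exact (h1.add (h2.mul contDiff_const)).mul (h3.mul contDiff_const).neg.cexp
  obtain ⟨K', hK'⟩ := lipschitzOnWith_comp_of_contDiffAt (hx.prodMk (hy.prodMk hK))
    fun t _ => hΦ.contDiffAt (x := (m.x i t, m.y i t, m.γ i t))
  refine ⟨K', ?_⟩
  convert! hK' using 1
  ext t
  simp only [Motion.relPos, Φ, Complex.mk_eq_add_mul_I]

theorem ae_hasDerivAt_relPos (hm : Follows G V xt yt m) (i : Fin n) {S : ℝ}
    (hS : S ∈ m.engaged xt yt) : ∀ᵐ t, t ∈ Ioo 0 S → HasDerivAt (m.relPos xt yt i)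
      (-(V i : ℂ) - (m.a i t / V i : ℝ) * Complex.I * m.relPos xt yt i t) t := by
  filter_upwards [(hm.intervalIntegrable_turnRate i hS).ae_hasDerivAt_integral] with t ht htI
  have htS := Motion.engaged_of_le hS htI.1.le htI.2.le
  have hγ : HasDerivAt (m.γ i) (m.a i t / V i) t := by
    have h := ht (by rw [uIcc_of_le hS.1]; exact Ioo_subset_Icc_self htI) 0 left_mem_uIcc
    refine (h.const_add (m.γ i 0)).congr_of_eventuallyEq ?_
    filter_upwards [Ioo_mem_nhds htI.1 htI.2] with u hu
    exact hm.heading i u (Motion.engaged_of_le hS hu.1.le hu.2.le)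
  have hx := (hm.deriv_x i t htS).hasDerivAt (Ici_mem_nhds htI.1)
  have hy := (hm.deriv_y i t htS).hasDerivAt (Ici_mem_nhds htI.1)
  have he := (((hx.const_sub xt).ofReal_comp).add ((hy.const_sub yt).ofReal_comp.mul_const
    Complex.I)).mul ((hγ.ofReal_comp.mul_const Complex.I).neg.cexp)
  -- In the body frame the heading is the real unit `1`, whence the term `-V`.
  have hexp : (Real.cos (m.γ i t) + Real.sin (m.γ i t) * Complex.I) *
      Complex.exp (-((m.γ i t : ℂ) * Complex.I)) = 1 := by
    rw [Complex.ofReal_cos, Complex.ofReal_sin, ← Complex.exp_mul_I, ← Complex.exp_add]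
    simp
  convert! he using 1
  · ext s
    simp [Motion.relPos, Complex.mk_eq_add_mul_I]
  · simp only [Motion.relPos, Complex.mk_eq_add_mul_I]
    push_cast at hexp ⊢
    simp only [Pi.add_apply, Pi.neg_apply]
    linear_combination (V i : ℂ) * hexp

/-- During the engagement the cross-range never vanishes. -/
theorem relPos_im_ne_zero (hm : Follows G V xt yt m) {i : Fin n}
    (h0 : (m.relPos xt yt i 0).im ≠ 0) {S : ℝ} (hS : S ∈ m.engaged xt yt) :
    (m.relPos xt yt i S).im ≠ 0 := by
  obtain ⟨K, hK⟩ := hm.relPos_lipschitz i hS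
  have hc : ContinuousOn (m.R xt yt i) (Icc 0 S) := (hm.continuousOn_R i).mono Icc_subset_Ici_self
  obtain ⟨t₀, ht₀, hmin⟩ := isCompact_Icc.exists_isMinOn (nonempty_Icc.2 hS.1) hc
  have hpos₀ : 0 < ‖m.relPos xt yt i t₀‖ :=
    norm_pos_iff.2 (Motion.relPos_ne_zero (Motion.engaged_of_le hS ht₀.1 ht₀.2) i)
  -- Grönwall argument: the cross-range changes at relative rate at most `C`, so its square times
  -- `exp (2 C t)` cannot decrease from its positive initial value.
  set C := 2 * |V i| / ‖m.relPos xt yt i t₀‖ with hCdef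
  have hΦ : ContDiff ℝ 1 fun p : ℂ × ℝ => p.1.im ^ 2 * Real.exp (2 * C * p.2) := by
    have him : ContDiff ℝ 1 (fun p : ℂ × ℝ => p.1.im) := Complex.imCLM.contDiff.comp contDiff_fst
    fun_prop
  obtain ⟨K', hK'⟩ := lipschitzOnWith_comp_of_contDiffAt
    (hK.prodMk (LipschitzWith.id.lipschitzOnWith (s := Icc 0 S)))
    fun t _ => hΦ.contDiffAt (x := (m.relPos xt yt i t, t))
  have hmono := monotoneOn_of_lipschitz_of_ae_hasDerivAt hK' (by
    filter_upwards [hm.ae_hasDerivAt_relPos i hS, hm.ae_exists_ratio i] with t hd hr htI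
    have htS := Motion.engaged_of_le hS htI.1.le htI.2.le
    obtain ⟨l, hl0, hl1, ha⟩ := hr htS
    have him : HasDerivAt (fun s => (m.relPos xt yt i s).im)
        (-(m.a i t / V i * (m.relPos xt yt i t).re)) t := by
      have := Complex.imCLM.hasFDerivAt.comp_hasDerivAt t (hd htI)
      convert! this using 1
      simp
    have hexp : HasDerivAt (fun s => Real.exp (2 * C * s)) (Real.exp (2 * C * t) * (2 * C)) t := by
      simpa using ((hasDerivAt_id t).const_mul (2 * C)).exp
    refine ⟨_, ?_, (him.pow 2).mul hexp⟩
    set z := m.relPos xt yt i t with hz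
    have hp : 0 < ‖z‖ := norm_pos_iff.2 (Motion.relPos_ne_zero htS i)
    have hR : m.R xt yt i t₀ ≤ m.R xt yt i t := hmin (Ioo_subset_Icc_self htI)
    rw [m.R_eq_norm, m.R_eq_norm] at hR
    have hbound : m.a i t / V i * z.re * z.im ≤ C * z.im ^ 2 := by
      rcases eq_or_ne (V i) 0 with hv | hv
      · simp [hv, hCdef]
      have h1 : m.a i t / V i * z.re * z.im = (l * (2 * V i) * z.re / ‖z‖ ^ 2) * z.im ^ 2 := by
        rw [ha, Complex.normSq_eq_norm_sq]; field_simp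
      rw [h1]
      refine mul_le_mul_of_nonneg_right ?_ (sq_nonneg _)
      calc l * (2 * V i) * z.re / ‖z‖ ^ 2 ≤ |l * (2 * V i) * z.re / ‖z‖ ^ 2| := le_abs_self _
        _ = l * (2 * |V i|) * |z.re| / ‖z‖ ^ 2 := by
          rw [abs_div, abs_mul, abs_mul, abs_mul, abs_of_nonneg hl0, abs_two,
            abs_of_nonneg (sq_nonneg ‖z‖)]
        _ ≤ 1 * (2 * |V i|) * ‖z‖ / ‖z‖ ^ 2 := by
          gcongr
          exact Complex.abs_re_le_norm z
        _ = 2 * |V i| / ‖z‖ := by field_simp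
        _ ≤ C := by rw [hCdef]; gcongr
    have he := Real.exp_pos (2 * C * t)
    simp only [Nat.cast_ofNat, Nat.add_one_sub_one, pow_one]
    have : 0 ≤ Real.exp (2 * C * t) * (2 * (C * z.im ^ 2 - m.a i t / V i * z.re * z.im)) := by
      apply mul_nonneg he.le; linarith
    simp only [Pi.pow_apply, id]
    rw [← hz]
    nlinarith [this])
  have h := hmono ⟨le_rfl, hS.1⟩ ⟨hS.1, le_rfl⟩ hS.1
  intro hz
  simp only [hz] at h
  norm_num at h
  exact h0 h

/-! ### Evolution of the estimated times -/

theorem tTilde_lipschitz (hm : Follows G V xt yt m) {i : Fin n} (hV : 0 < V i)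
    (h0 : (m.relPos xt yt i 0).im ≠ 0) {S : ℝ} (hS : S ∈ m.engaged xt yt) :
    ∃ K, LipschitzOnWith K (fun t => m.tTilde V xt yt t i + t) (Icc 0 S) := by
  obtain ⟨K, hK⟩ := hm.relPos_lipschitz i hS
  obtain ⟨K', hK'⟩ := lipschitzOnWith_comp_of_contDiffAt hK fun t ht =>
    contDiffAt_estTimeOfPos hV.ne'
      (hm.relPos_im_ne_zero h0 (Motion.engaged_of_le hS ht.1 ht.2))
  refine ⟨K' + 1, ?_⟩
  convert! hK'.add (LipschitzWith.id.lipschitzOnWith (s := Icc 0 S)) using 1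
  ext t
  simp [m.tTilde_eq]

theorem ae_hasDerivAt_tTilde (hm : Follows G V xt yt m) {i : Fin n} (hV : 0 < V i)
    (h0 : (m.relPos xt yt i 0).im ≠ 0) {S : ℝ} (hS : S ∈ m.engaged xt yt) :
    ∀ᵐ t, t ∈ Ioo 0 S → ∃ d, 0 ≤ d ∧ HasDerivAt (fun t => m.tTilde V xt yt t i + t) d t ∧
      (m.a i t = circAccel (V i) (m.R xt yt i t) (m.θ xt yt i t) → d = 0) := by
  filter_upwards [hm.ae_hasDerivAt_relPos i hS, hm.ae_exists_ratio i] with t hd hr htI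
  have htS := Motion.engaged_of_le hS htI.1.le htI.2.le
  have him := hm.relPos_im_ne_zero h0 htS
  have key : ∀ l, m.a i t = l * (2 * V i ^ 2 * (m.relPos xt yt i t).im /
        Complex.normSq (m.relPos xt yt i t)) → HasDerivAt (fun t => m.tTilde V xt yt t i + t)
        (2 * (1 - l) * (1 - (m.relPos xt yt i t).arg * (m.relPos xt yt i t).re /
          (m.relPos xt yt i t).im)) t := by
    intro l ha
    have h := (hasDerivAt_estTimeOfPos hV him ha (hd htI)).add (hasDerivAt_id t)
    convert! h using 1
    · ext s; simp [m.tTilde_eq]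
    · ring
  obtain ⟨l, hl0, hl1, ha⟩ := hr htS
  refine ⟨_, ?_, key l ha, fun hcirc => ?_⟩
  · have := arg_mul_re_div_im_le_one him
    exact mul_nonneg (by linarith) (by linarith)
  · rw [m.R_eq_norm, m.θ_eq_arg, circAccel_norm_arg] at hcirc
    -- Uniqueness of the derivative replaces solving for `l`.
    have := (key l ha).unique (key 1 (by rw [hcirc, one_mul]))
    rw [this]; ring

theorem monotoneOn_tTilde_add (hm : Follows G V xt yt m) {i : Fin n} (hV : 0 < V i)
    (h0 : (m.relPos xt yt i 0).im ≠ 0) :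
    MonotoneOn (fun t => m.tTilde V xt yt t i + t) (m.engaged xt yt) := by
  intro s hs t ht hst
  obtain ⟨K, hK⟩ := hm.tTilde_lipschitz hV h0 ht
  refine monotoneOn_of_lipschitz_of_ae_hasDerivAt hK ?_ ⟨hs.1, hst⟩ ⟨ht.1, le_rfl⟩ hst
  filter_upwards [hm.ae_hasDerivAt_tTilde hV h0 ht] with u hu huI
  obtain ⟨d, hd, hd', -⟩ := hu huI
  exact ⟨d, hd, hd'⟩

end Follows

/-! ### Local leaders -/

theorem mem_members_of_adj {c : SCC G} (hc : c ∈ terminal G) {i j : Fin n}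
    (hi : i ∈ members G c) (h : G.Adj i j) : j ∈ members G c := by
  have hs : IsSink (condensation G) c := hc.elim id fun h d => (h d).1
  by_contra hj
  exact hs (Quotient.mk (sccSetoid G) j) ⟨fun he => hj he.symm, i, j, h, hi, rfl⟩

/-- Among the nodes reachable from `i`, take one with the fewest reachable nodes. An edge leaving
its component would lead to a node with a strictly smaller reachable set. -/
theorem exists_reachable_terminal (G : Digraph (Fin n)) (i : Fin n) :
    ∃ c ∈ terminal G, ∃ j ∈ members G c, Relation.ReflTransGen G.Adj i j := by
  obtain ⟨j, hij, hmin⟩ := Set.exists_min_image {j | Relation.ReflTransGen G.Adj i j}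
    (fun j => {k | Relation.ReflTransGen G.Adj j k}.ncard) (Set.toFinite _) ⟨i, .refl⟩
  refine ⟨Quotient.mk (sccSetoid G) j, Or.inl ?_, j, rfl, hij⟩
  rintro d ⟨hne, k, l, hkl, hk, hl⟩
  have hjk : Relation.ReflTransGen G.Adj k j ∧ Relation.ReflTransGen G.Adj j k :=
    Quotient.exact hk
  have hjl := hjk.2.tail hkl
  have hlj : ¬ Relation.ReflTransGen G.Adj l j := fun h =>
    hne (by rw [← hl]; exact Quotient.sound ⟨hjl, h⟩)
  refine absurd (hmin l (Relation.ReflTransGen.trans hij hjl)) (not_le.2 ?_)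
  exact Set.ncard_lt_ncard ⟨fun p hp => hjl.trans hp, fun h => hlj (h .refl)⟩ (Set.toFinite _)

theorem exists_reachable_localLeader (G : Digraph (Fin n)) (τ : Fin n → ℝ) (i : Fin n) :
    ∃ l ∈ localLeaders G τ, Relation.ReflTransGen G.Adj i l := by
  obtain ⟨c, hc, j, hj, hij⟩ := exists_reachable_terminal G i
  obtain ⟨l, hl, hmax⟩ := Set.exists_max_image (members G c) τ (Set.toFinite _) ⟨j, hj⟩
  have hjl : Relation.ReflTransGen G.Adj j l ∧ Relation.ReflTransGen G.Adj l j :=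
    Quotient.exact (Eq.trans hj (Eq.symm hl))
  exact ⟨l, mem_iUnion₂.2 ⟨c, hc, hl, hmax⟩, hij.trans hjl.1⟩

theorem argminOn_localLeaders_nonempty (G : Digraph (Fin n)) (τ : Fin n → ℝ) (hn : 0 < n) :
    (argminOn τ (localLeaders G τ)).Nonempty := by
  obtain ⟨l, hl, -⟩ := exists_reachable_localLeader G τ ⟨0, hn⟩
  obtain ⟨f, hf, hmin⟩ := Set.exists_min_image (localLeaders G τ) τ (Set.toFinite _) ⟨l, hl⟩
  exact ⟨f, hf, hmin⟩

theorem lt_maxOut_of_adj {τ : Fin n → ℝ} {j k : Fin n} (h : G.Adj j k) (hlt : τ j < τ k) :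
    τ j < maxOut G τ j := by
  classical
  refine hlt.trans_le (Finset.le_sup' (f := τ) ?_)
  simp [h]

theorem maxOut_le_of_mem_terminal {τ : Fin n → ℝ} {c : SCC G} (hc : c ∈ terminal G) {j : Fin n}
    (hj : j ∈ members G c) {M : ℝ} (hM : ∀ k ∈ members G c, τ k ≤ M) : maxOut G τ j ≤ M := by
  classical
  refine Finset.sup'_le _ _ fun k hk => ?_
  rcases Finset.mem_insert.1 hk with rfl | hk
  · exact hM _ hj
  · exact hM k (mem_members_of_adj hc hj (Finset.mem_filter.1 hk).2)

/-- A pursuer with the largest estimated time in a terminal component flies on the circle. -/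
theorem GuidanceLaw.eq_circ_of_argmax {τ : Fin n → ℝ} {c : SCC G} (hc : c ∈ terminal G)
    {j : Fin n} (hj : j ∈ argmaxOn τ (members G c)) {a a' : ℝ} (h : GuidanceLaw G τ j a a') :
    a = a' := by
  rcases h.2 (maxOut_le_of_mem_terminal hc hj.1 hj.2) with h | ⟨⟨k, hk, hlt⟩, -⟩
  · exact h
  · exfalso
    -- Edges do not leave the component and ties preserve the value, so a path of ties ends at
    -- another maximizer, which cannot be a straight flyer.
    have : k ∈ members G c ∧ τ k = τ j := by
      clear hlt
      induction hk with
      | refl => exact ⟨hj.1, rfl⟩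
      | tail _ h ih => exact ⟨mem_members_of_adj hc ih.1 h.1, h.2.trans ih.2⟩
    have h1 := maxOut_le_of_mem_terminal hc this.1 hj.2
    rw [this.2] at hlt
    linarith

theorem lipschitzOnWith_sup' {ι : Type*} [Fintype ι] {s : Finset ι} (hs : s.Nonempty)
    {h : ι → ℝ → ℝ} {D : Set ℝ} {K : ι → NNReal} (hK : ∀ j, LipschitzOnWith (K j) (h j) D) :
    LipschitzOnWith (∑ j, K j) (fun t => s.sup' hs fun j => h j t) D := by
  refine LipschitzOnWith.of_le_add_mul _ fun u hu v hv => Finset.sup'_le _ _ fun j hj => ?_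
  have h1 := (hK j).le_add_mul hu hv
  have h2 : h j v ≤ s.sup' hs fun j => h j v := Finset.le_sup' (fun j => h j v) hj
  have h3 : K j ≤ ∑ j, K j := Finset.single_le_sum (fun _ _ => zero_le) (Finset.mem_univ j)
  have h4 : (K j : ℝ) * dist u v ≤ (∑ j, K j : NNReal) * dist u v := by gcongr
  linarith

namespace Follows

/-- The estimated time of interception of a local leader decreases at unit rate. -/
theorem tTilde_localLeader (hm : Follows G V xt yt m) (hV : ∀ i, 0 < V i)
    (h0 : ∀ i, (m.relPos xt yt i 0).im ≠ 0) {f : Fin n}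
    (hf : f ∈ localLeaders G (m.tTilde V xt yt 0)) {S : ℝ} (hS : S ∈ m.engaged xt yt) :
    m.tTilde V xt yt S f = m.tTilde V xt yt 0 f - S := by
  classical
  obtain ⟨c, hc, hfc, hmax⟩ := mem_iUnion₂.1 hf
  let s : Finset (Fin n) := Finset.univ.filter (· ∈ members G c)
  have hms : ∀ j, j ∈ s ↔ j ∈ members G c := fun j => by simp [s]
  have hs : s.Nonempty := ⟨f, (hms f).2 hfc⟩
  set h : Fin n → ℝ → ℝ := fun j t => m.tTilde V xt yt t j + t with hh
  set g : ℝ → ℝ := fun t => s.sup' hs fun j => h j t with hg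
  have hle : ∀ j ∈ members G c, ∀ t, h j t ≤ g t := fun j hj t =>
    Finset.le_sup' (fun j => h j t) ((hms j).2 hj)
  choose K hK using fun i => hm.tTilde_lipschitz (hV i) (h0 i) hS
  have hgL := lipschitzOnWith_sup' hs hK
  have hdiff := (LipschitzOnWith.absolutelyContinuousOnInterval
    (a := 0) (b := S) (by rwa [uIcc_of_le hS.1])).ae_differentiableAt (f := g)
  have hmono := monotoneOn_of_lipschitz_of_ae_hasDerivAt hgL.neg (by
    filter_upwards [hdiff, hm.law, ae_all_iff.2 fun i => hm.ae_hasDerivAt_tTilde (hV i) (h0 i) hS]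
      with t hdt hlaw hder htI
    have htS := Motion.engaged_of_le hS htI.1.le htI.2.le
    have hgd := (hdt (by rw [uIcc_of_le hS.1]; exact Ioo_subset_Icc_self htI)).hasDerivAt
    obtain ⟨j, hj, hgj⟩ := Finset.exists_mem_eq_sup' hs fun j => h j t
    rw [hms] at hj
    obtain ⟨d, -, hd, hd0⟩ := hder j htI
    have hjmax : j ∈ argmaxOn (m.tTilde V xt yt t) (members G c) := by
      refine ⟨hj, fun k hk => ?_⟩
      have := (hle k hk t).trans_eq hgj
      simp only [hh] at this
      linarith
    have hd0 := hd0 ((hlaw htS j).eq_circ_of_argmax hc hjmax)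
    -- The maximum `g` touches `h j` from above at `t`, so their derivatives agree there; that of `h
    -- j` is `0` on the circle.
    have hmin : IsLocalMin (fun u => g u - h j u) t := by
      refine Eventually.of_forall fun u => ?_
      have h1 := hle j hj u
      have h2 : g t = h j t := hgj
      simp only
      linarith
    have := hmin.hasDerivAt_eq_zero (hgd.sub hd)
    refine ⟨0, le_rfl, ?_⟩
    have hz : deriv g t = 0 := by linarith
    rw [hz] at hgd
    simpa using hgd.neg)
  -- Squeeze: `h f S ≤ g S ≤ g 0 ≤ h f 0 ≤ h f S`.
  have h1 := hmono ⟨le_rfl, hS.1⟩ ⟨hS.1, le_rfl⟩ hS.1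
  have h2 : g 0 ≤ h f 0 := Finset.sup'_le _ _ fun k hk => by
    have := hmax k ((hms k).1 hk)
    simp only [hh]; linarith
  have h3 := hle f hfc S
  have h4 := hm.monotoneOn_tTilde_add (hV f) (h0 f)
    (Motion.engaged_of_le hS le_rfl hS.1) hS hS.1
  have h5 : -g 0 ≤ -g S := h1
  simp only [hh] at h2 h3 h4
  linarith

/-! ### The first interception -/

/-- The cross-range of a pursuer flying straight is constant. -/
theorem relPos_im_eq_of_straight (hm : Follows G V xt yt m) {j : Fin n} {s S : ℝ} (hs : 0 ≤ s)
    (hsS : s ≤ S) (hS : S ∈ m.engaged xt yt)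
    (hlt : ∀ t ∈ Icc s S, m.tTilde V xt yt t j < maxOut G (m.tTilde V xt yt t) j) :
    (m.relPos xt yt j S).im = (m.relPos xt yt j s).im := by
  obtain ⟨K, hK⟩ := hm.relPos_lipschitz j hS
  obtain ⟨K', hK'⟩ := lipschitzOnWith_comp_of_contDiffAt (Φ := fun z : ℂ => z.im) hK
    fun t _ => Complex.imCLM.contDiff.contDiffAt
  have hsub : uIcc s S ⊆ Icc 0 S := by
    rw [uIcc_of_le hsS]; exact Icc_subset_Icc_left hs
  obtain ⟨C, hC⟩ := (hK'.mono hsub).absolutelyContinuousOnInterval.const_of_ae_hasDerivAt_zero (by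
    have h1 : ∀ᵐ u : ℝ, u ≠ 0 := by simp [ae_iff, measure_singleton]
    have h2 : ∀ᵐ u : ℝ, u ≠ S := by simp [ae_iff, measure_singleton]
    filter_upwards [hm.ae_hasDerivAt_relPos j hS, hm.law, h1, h2] with t hd hlaw ht0 htS htI
    have htI' := hsub htI
    rw [uIcc_of_le hsS] at htI
    have ha := (hlaw (Motion.engaged_of_le hS htI'.1 htI'.2) j).1 (hlt t htI)
    have := Complex.imCLM.hasFDerivAt.comp_hasDerivAt t
      (hd ⟨lt_of_le_of_ne htI'.1 ht0.symm, lt_of_le_of_ne htI'.2 htS⟩)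
    convert! this using 1
    simp [ha])
  rw [hC S right_mem_uIcc, hC s left_mem_uIcc]

/-- The squared distance has derivative `-2 V Re z`. If the target stayed behind the pursuer up to
`T`, the distance could not drop to zero. -/
theorem exists_re_nonneg_of_intercepts (hm : Follows G V xt yt m) {i : Fin n} (hV : 0 < V i)
    {T : ℝ} (hT : Ico 0 T ⊆ m.engaged xt yt) (hi : m.InterceptsAt xt yt i T) {s ε : ℝ}
    (hs : s ∈ Ico 0 T) (hε : 0 < ε) :
    ∃ t ∈ Ico s T, ‖m.relPos xt yt i t‖ < ε ∧ 0 ≤ (m.relPos xt yt i t).re := by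
  have hT0 : 0 ≤ T := hs.1.trans hs.2.le
  have hcR := hm.continuousOn_R i T hT0
  rw [Metric.continuousWithinAt_iff] at hcR
  obtain ⟨δ, hδ, hnear⟩ := hcR ε hε
  rw [(m.interceptsAt_iff xt yt i T).1 hi] at hnear
  set s' := max s (T - δ / 2) with hs'
  have hss' : s ≤ s' := le_max_left _ _
  have hs'T : s' < T := max_lt hs.2 (by linarith)
  have hs'0 : 0 ≤ s' := hs.1.trans hss'
  by_contra! hneg
  have hre : ∀ t ∈ Ico s' T, (m.relPos xt yt i t).re < 0 := fun t ht => by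
    refine hneg t ⟨hss'.trans ht.1, ht.2⟩ ?_
    have h1 : T - δ / 2 ≤ t := (le_max_right _ _).trans ht.1
    have := hnear (hs'0.trans ht.1 : (0 : ℝ) ≤ t) (by
      rw [Real.dist_eq, abs_lt]; constructor <;> linarith [ht.2])
    rw [Real.dist_eq, sub_zero, m.R_eq_norm, abs_of_nonneg (norm_nonneg _)] at this
    exact this
  have hder : ∀ t ∈ Ioo s' T, HasDerivAt
      (fun t => (xt - m.x i t) ^ 2 + (yt - m.y i t) ^ 2)
      (-2 * V i * (m.relPos xt yt i t).re) t := fun t ht => by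
    have ht0 : 0 < t := hs'0.trans_lt ht.1
    have hx := (hm.deriv_x i t (hT ⟨ht0.le, ht.2⟩)).hasDerivAt (Ici_mem_nhds ht0)
    have hy := (hm.deriv_y i t (hT ⟨ht0.le, ht.2⟩)).hasDerivAt (Ici_mem_nhds ht0)
    convert! ((hx.const_sub xt).pow 2).add ((hy.const_sub yt).pow 2) using 1
    rw [Motion.relPos, ← neg_mul, ← Complex.ofReal_neg, Complex.mul_re,
      Complex.exp_ofReal_mul_I_re, Complex.exp_ofReal_mul_I_im, Real.cos_neg, Real.sin_neg]
    simp only [Nat.cast_ofNat, Nat.add_one_sub_one, pow_one]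
    ring
  have hmono : MonotoneOn (fun t => (xt - m.x i t) ^ 2 + (yt - m.y i t) ^ 2) (Icc s' T) := by
    refine monotoneOn_of_deriv_nonneg (convex_Icc _ _) ?_ ?_ ?_
    · have hsub : Icc s' T ⊆ Ici 0 := fun t ht => hs'0.trans ht.1
      have hx := (hm.cont_x i).mono hsub
      have hy := (hm.cont_y i).mono hsub
      fun_prop
    · rw [interior_Icc]
      exact fun t ht => (hder t ht).differentiableAt.differentiableWithinAt
    · rw [interior_Icc]
      intro t ht
      rw [(hder t ht).deriv]
      nlinarith [hre t ⟨ht.1.le, ht.2⟩]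
  have h := hmono ⟨le_rfl, hs'T.le⟩ ⟨hs'T.le, le_rfl⟩ hs'T.le
  simp only [hi.1, hi.2] at h
  refine (hT ⟨hs'0, hs'T⟩).2 s' ⟨hs'0, le_rfl⟩ i ?_
  rw [m.interceptsAt_iff, Motion.R, targetDist]
  exact Real.sqrt_eq_zero_of_nonpos (by linarith)

/-- The estimated time of interception of the first pursuer to intercept is never more than the
remaining time. -/
theorem tTilde_add_le_of_intercepts (hm : Follows G V xt yt m) {i : Fin n} (hV : 0 < V i)
    (h0 : (m.relPos xt yt i 0).im ≠ 0) {T : ℝ} (hT : Ico 0 T ⊆ m.engaged xt yt)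
    (hi : m.InterceptsAt xt yt i T) {s : ℝ} (hs : s ∈ Ico 0 T) :
    m.tTilde V xt yt s i + s ≤ T := by
  refine le_of_forall_pos_le_add fun ε hε => ?_
  obtain ⟨t, ht, hR, hre⟩ := hm.exists_re_nonneg_of_intercepts hV hT hi hs
    (show 0 < V i * ε / (Real.pi / 2) by positivity)
  have hte : t ∈ m.engaged xt yt := hT ⟨hs.1.trans ht.1, ht.2⟩
  have h1 := hm.monotoneOn_tTilde_add hV h0 (hT hs) hte ht.1
  have h2 := estTimeOfPos_le_norm hV (hm.relPos_im_ne_zero h0 hte) hre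
  rw [← m.tTilde_eq] at h2
  rw [lt_div_iff₀ (by positivity)] at hR
  have h3 : m.tTilde V xt yt t i ≤ ε := by
    refine le_of_mul_le_mul_left ?_ hV
    linarith
  simp only at h1
  linarith [ht.2]

/-- The first interception does not take place before the smallest initial estimate of a local
leader. -/
theorem exists_localLeader_le_of_intercepts (hm : Follows G V xt yt m) (hV : ∀ i, 0 < V i)
    (h0 : ∀ i, (m.relPos xt yt i 0).im ≠ 0) {T : ℝ} (hT0 : 0 < T)
    (hT : Ico 0 T ⊆ m.engaged xt yt) {i : Fin n} (hi : m.InterceptsAt xt yt i T) :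
    ∃ l ∈ localLeaders G (m.tTilde V xt yt 0), m.tTilde V xt yt 0 l ≤ T := by
  obtain ⟨l, hl, hil⟩ := exists_reachable_localLeader G (m.tTilde V xt yt 0) i
  -- The induction along the path needs the bound at all times, since each edge uses it close to
  -- `T`.
  suffices h : ∀ s ∈ Ico 0 T, m.tTilde V xt yt s l + s ≤ T from
    ⟨l, hl, by simpa using h 0 ⟨le_rfl, hT0⟩⟩
  clear hl
  induction hil with
  | refl => exact fun s hs => hm.tTilde_add_le_of_intercepts (hV i) (h0 i) hT hi hs
  | @tail j k _ hjk ih =>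
    by_contra! hk
    obtain ⟨s, hs, hks⟩ := hk
    have hlt : ∀ t ∈ Ico s T, m.tTilde V xt yt t j < maxOut G (m.tTilde V xt yt t) j := by
      intro t ht
      have ht' : t ∈ Ico 0 T := ⟨hs.1.trans ht.1, ht.2⟩
      refine lt_maxOut_of_adj hjk ?_
      have h1 := hm.monotoneOn_tTilde_add (hV k) (h0 k) (hT hs) (hT ht') ht.1
      have h2 := ih t ht'
      simp only at h1
      linarith
    have hpos : 0 < |(m.relPos xt yt j s).im| :=
      abs_pos.2 (hm.relPos_im_ne_zero (h0 j) (hT hs))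
    have hVj := hV j
    set c := |(m.relPos xt yt j s).im| with hc
    -- So late, `c ≤ V_j t̃_j ≤ V_j (T - t) ≤ c / 2`, a contradiction.
    obtain ⟨t, ht1, ht2⟩ : ∃ t, max s (T - c / (2 * V j)) ≤ t ∧ t < T :=
      ⟨_, le_rfl, max_lt hs.2 (by linarith [show 0 < c / (2 * V j) by positivity])⟩
    have hst : s ≤ t := (le_max_left _ _).trans ht1
    have ht3 : T - t ≤ c / (2 * V j) := by linarith [(le_max_right s (T - c / (2 * V j))).trans ht1]
    have hte := hT ⟨hs.1.trans hst, ht2⟩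
    have him := hm.relPos_im_eq_of_straight hs.1 hst hte
      fun u hu => hlt u ⟨hu.1, hu.2.trans_lt ht2⟩
    have h1 : c ≤ V j * m.tTilde V xt yt t j := by
      rw [hc, ← him, m.tTilde_eq]
      exact (Complex.abs_im_le_norm _).trans
        (norm_le_estTimeOfPos (hV j) (hm.relPos_im_ne_zero (h0 j) hte))
    have h2 := ih t ⟨hs.1.trans hst, ht2⟩
    rw [le_div_iff₀ (by positivity)] at ht3
    nlinarith

end Follows

end Pursuit

open Pursuit Set Filter Topology in
theorem mainTheorem5 (n : ℕ) (hn : 0 < n) (G : Digraph (Fin n))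
    (V : Fin n → ℝ) (hV : ∀ i, 0 < V i) (xt yt : ℝ) (m : Pursuit.Motion n)
    (hθ : ∀ i, m.θ xt yt i 0 ≠ 0 ∧ m.θ xt yt i 0 ≠ Real.pi)
    (hm : Pursuit.Follows G V xt yt m) :
    (Pursuit.argminOn (m.tTilde V xt yt 0)
      (Pursuit.localLeaders G (m.tTilde V xt yt 0))).Nonempty ∧
    ∀ f ∈ Pursuit.argminOn (m.tTilde V xt yt 0)
        (Pursuit.localLeaders G (m.tTilde V xt yt 0)),
      0 < m.tTilde V xt yt 0 f ∧
      m.InterceptsAt xt yt f (m.tTilde V xt yt 0 f) ∧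
      ∀ i, ∀ t, 0 ≤ t → t < m.tTilde V xt yt 0 f → ¬ m.InterceptsAt xt yt i t := by
  have h0 : ∀ i, (m.relPos xt yt i 0).im ≠ 0 := fun i him => by
    obtain ⟨h1, h2⟩ := hθ i
    rw [m.θ_eq_arg] at h1 h2
    rcases le_or_gt 0 (m.relPos xt yt i 0).re with h | h
    · exact h1 (Complex.arg_eq_zero_iff.2 ⟨h, him⟩)
    · exact h2 (Complex.arg_eq_pi_iff.2 ⟨h, him⟩)
  refine ⟨argminOn_localLeaders_nonempty G _ hn, fun f ⟨hf, hmin⟩ => ?_⟩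
  set T := m.tTilde V xt yt 0 f with hTdef
  have hpos : 0 < T := by
    have h1 := norm_le_estTimeOfPos (hV f) (h0 f)
    rw [← m.tTilde_eq] at h1
    have h2 : 0 < ‖m.relPos xt yt f 0‖ := norm_pos_iff.2 fun h => h0 f (by rw [h]; rfl)
    exact pos_of_mul_pos_right (h2.trans_le h1) (hV f).le
  have hno : ∀ i, ∀ t, 0 ≤ t → t < T → ¬ m.InterceptsAt xt yt i t := by
    intro i t ht htT hit
    -- The set of interception times is closed, so there is a first one; it is positive because
    -- every initial cross-range is nonzero.
    let B : Set ℝ := ⋃ j, Ici 0 ∩ m.R xt yt j ⁻¹' {0}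
    have hB : IsClosed B := isClosed_iUnion_of_finite fun j =>
      (hm.continuousOn_R j).preimage_isClosed_of_isClosed isClosed_Ici isClosed_singleton
    have hbdd : BddBelow B := ⟨0, fun u hu => by
      obtain ⟨j, hj⟩ := mem_iUnion.1 hu
      exact hj.1⟩
    have hmemB : ∀ u j, 0 ≤ u → m.InterceptsAt xt yt j u → u ∈ B := fun u j hu hj =>
      mem_iUnion.2 ⟨j, hu, (m.interceptsAt_iff xt yt j u).1 hj⟩
    have htB := hmemB t i ht hit
    obtain ⟨j, hj0, hj⟩ := mem_iUnion.1 (hB.csInf_mem ⟨t, htB⟩ hbdd)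
    have hjI : m.InterceptsAt xt yt j (sInf B) := (m.interceptsAt_iff xt yt j _).2 hj
    have hinf : sInf B ≤ t := csInf_le hbdd htB
    have hinf0 : 0 < sInf B := by
      refine lt_of_le_of_ne hj0 fun he => ?_
      rw [← he, m.interceptsAt_iff, m.R_eq_norm, norm_eq_zero] at hjI
      exact h0 j (by rw [hjI]; rfl)
    have heng : Ico 0 (sInf B) ⊆ m.engaged xt yt := fun u hu =>
      ⟨hu.1, fun w hw k hk => absurd (csInf_le hbdd (hmemB w k hw.1 hk))
        (not_le.2 (hw.2.trans_lt hu.2))⟩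
    obtain ⟨l, hl, hle⟩ := hm.exists_localLeader_le_of_intercepts hV h0 hinf0 heng hjI
    linarith [hmin l hl]
  refine ⟨hpos, ?_, hno⟩
  have heng : Ico 0 T ⊆ m.engaged xt yt := fun u hu =>
    ⟨hu.1, fun w hw k => hno k w hw.1 (hw.2.trans_lt hu.2)⟩
  -- The law is known only before `T`; this bound and continuity of the position settle time `T`
  -- itself.
  have hbound : ∀ t ∈ Ico 0 T, m.R xt yt f t ≤ V f * (T - t) := fun t ht => by
    have h1 := norm_le_estTimeOfPos (hV f) (hm.relPos_im_ne_zero (h0 f) (heng ht))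
    rwa [← m.tTilde_eq, ← m.R_eq_norm, hm.tTilde_localLeader hV h0 hf (heng ht)] at h1
  rw [m.interceptsAt_iff]
  refine le_antisymm ?_ (Real.sqrt_nonneg _)
  have hne : (𝓝[Ico 0 T] T).NeBot := by
    rw [← mem_closure_iff_nhdsWithin_neBot, closure_Ico hpos.ne]
    exact ⟨hpos.le, le_rfl⟩
  have hlim1 : Tendsto (m.R xt yt f) (𝓝[Ico 0 T] T) (𝓝 (m.R xt yt f T)) :=
    (hm.continuousOn_R f T hpos.le).mono_left (nhdsWithin_mono _ fun t ht => ht.1)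
  have hlim2 : Tendsto (fun t => V f * (T - t)) (𝓝[Ico 0 T] T) (𝓝 0) := by
    have : Continuous fun t => V f * (T - t) := by fun_prop
    simpa using (this.tendsto T).mono_left nhdsWithin_le_nhds
  exact le_of_tendsto_of_tendsto hlim1 hlim2
    (eventually_nhdsWithin_of_forall hbound)
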